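/- Let $\mathcal N$ be a countable index set, $\ell^p=\ell^p(\mathcal N)$ the space of real $p$-summable families with norm $\|\cdot\|_p$ ($1\le p\le\infty$), and $\mathcal B(\ell^p)$ the bounded linear operators on $\ell^p$. Let $2\le p_0\le\infty$, and let $\mathcal A$ be a Banach algebra of infinite matrices $(a(i,j))_{i,j\in\mathcal N}$, with norm $\|\cdot\|_{\mathcal A}$, which (acting by matrix multiplication) is a Banach subalgebra of, that is, continuously embedded in, $\mathcal B(\ell^q)$ for every $1\le q\le\infty$. Assume the following. (a) $\mathcal A$ admits norm control in $\mathcal B(\ell^2)$: there is a continuous $h:[0,\infty)^2\to[0,\infty)$ such that every $A\in\mathcal A$ that is invertible in $\mathcal B(\ell^2)$ satisfies $A^{-1}\in\mathcal A$ and $\|A^{-1}\|_{\mathcal A}\le h(\|A\|_{\mathcal A},\|A^{-1}\|_{\mathcal B(\ell^2)})$. (b) There are nested finite sets $\mathcal N_1\subset\mathcal N_2\subset\cdots$ with union $\mathcal N$ such that the coordinate projections $P_mx=(x(n)\chi_{\mathcal N_m}(n))_{n\in\mathcal N}$ satisfy $$\lim_{m\to\infty}\ \sup_{\|A\|_{\mathcal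 A}\le1}\|P_mA(I-P_{m+1})\|_{\mathcal B(\ell^\infty)}=0 .$$ Let $f:\ell^{p_0}\to\ell^{p_0}$ be continuous with $f(0)=0$, with gradient $\nabla f(x)c=\lim_{t\to0}(f(x+tc)-f(x))/t$ given by matrices $\nabla f(x)\in\mathcal A$ such that $x\mapsto\nabla f(x)$ is bounded and continuous from $\ell^{p_0}$ to $\mathcal A$. Assume that for some $m_0>0$ and $C_1\in(0,\infty)$ $$c^T\nabla f(x)c\ge m_0\,c^Tc\quad(c\in\ell^2,\ x\in\ell^{p_0}),\qquad \|\nabla f(x)-\nabla f(x')\|_{\mathcal A}\le C_1\|x-x'\|_{p_0}\quad(x,x'\in\ell^{p_0}).$$ Let $1\le p\le p_0$. Then every $\nabla f(x)$, $x\in\ell^{p_0}$, has an inverse in $\mathcal A$, which is its inverse on $\ell^p$; $f$ maps $\ell^p$ into $\ell^p$; and for every $y\in\ell^p$ the equation $f(x)=y$ has a unique solution $f^{-1}(y)$ in $\ell^p$. Moreover, there is a constant $C>0$, independent of $y$ and $x_0$, such that for every $y\in\ell^p$ there is $\delta>0$ with the following property: if $x_0\in\ell^p$ and $\|x_0-f^{-1}(y)\|_p<\delta$,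 then the quasi-Newton iteration $$x_{n+1}=x_n-(\nabla f(x_n))^{-1}(f(x_n)-y),\qquad n\ge0,$$ satisfies $$\|x_{n+1}-x_n\|_p\le C\,\|x_n-x_{n-1}\|_p^2\qquad\text{for all } n\ge1,$$ and $x_n$ converges in $\ell^p$ R-quadratically to $f^{-1}(y)$, i.e. there are $\varepsilon_n\to0$ and $K$ with $\|x_n-f^{-1}(y)\|_p\le\varepsilon_n$ and $\varepsilon_{n+1}\le K\varepsilon_n^2$ for all $n\ge0$. -/

import Mathlib

open Filter Topology
open scoped ENNReal

noncomputable section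

/-- The space `ℓ^p(N)` of real `p`-summable families indexed by `N`. -/
abbrev Ell (N : Type*) (p : ℝ≥0∞) := lp (fun _ : N => ℝ) p

/-- The infinite matrix `a` represents the bounded operator `T` on `ℓ^q(N)`:
`(T x) i = ∑ j, a i j * x j` with (absolutely) convergent sums. -/
def Represents {N : Type*} {q : ℝ≥0∞} [Fact (1 ≤ q)] (a : Matrix N N ℝ)
    (T : Ell N q →L[ℝ] Ell N q) : Prop :=
  ∀ (x : Ell N q) (i : N), HasSum (fun j => a i j * x j) (T x i)

/-- The product of two infinite matrices. -/
def matProd {N : Type*} (a b : Matrix N N ℝ) : Matrix N N ℝ :=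
  Matrix.of fun i k => ∑' j, a i j * b j k

/-- A Banach algebra `𝒜` of infinite matrices (with respect to its own complete norm, for which
multiplication is continuous) that is a Banach subalgebra of `ℬ(ℓ^q(N))`
for every `1 ≤ q ≤ ∞`, that is, continuously embedded in each of them.
It is not assumed that `𝒜` has a unit. -/
structure BanachMatrixAlgebra (N : Type*) where
  carrier : Submodule ℝ (Matrix N N ℝ)
  norm : Seminorm ℝ carrier
  eq_zero_of_norm : ∀ a : carrier, norm a = 0 → a = 0
  complete : ∀ u : ℕ → carrier,
    (∀ ε : ℝ, 0 < ε → ∃ n₀, ∀ m ≥ n₀, ∀ n ≥ n₀, norm (u m - u n) < ε) →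
      ∃ a : carrier, Tendsto (fun n => norm (u n - a)) atTop (𝓝 0)
  mul_mem : ∀ a b : carrier, matProd (a : Matrix N N ℝ) (b : Matrix N N ℝ) ∈ carrier
  norm_mul : ∃ K : ℝ, ∀ a b : carrier,
    norm ⟨matProd (a : Matrix N N ℝ) (b : Matrix N N ℝ), mul_mem a b⟩ ≤ K * norm a * norm b
  embed : ∀ (q : ℝ≥0∞) [Fact (1 ≤ q)], ∃ M : ℝ, ∀ a : carrier,
    ∃ T : Ell N q →L[ℝ] Ell N q, Represents (a : Matrix N N ℝ) T ∧ ‖T‖ ≤ M * norm a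

namespace BanachMatrixAlgebra

variable {N : Type*} (𝒜 : BanachMatrixAlgebra N)

theorem exists_op (q : ℝ≥0∞) [Fact (1 ≤ q)] (a : 𝒜.carrier) :
    ∃ T : Ell N q →L[ℝ] Ell N q, Represents (a : Matrix N N ℝ) T := by
  obtain ⟨M, hM⟩ := 𝒜.embed q
  obtain ⟨T, hT, -⟩ := hM a
  exact ⟨T, hT⟩

/-- The bounded operator on `ℓ^q(N)` given by a matrix in `𝒜`. -/
def op (q : ℝ≥0∞) [Fact (1 ≤ q)] (a : 𝒜.carrier) : Ell N q →L[ℝ] Ell N q :=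
  (𝒜.exists_op q a).choose

theorem op_represents (q : ℝ≥0∞) [Fact (1 ≤ q)] (a : 𝒜.carrier) :
    Represents (a : Matrix N N ℝ) (𝒜.op q a) :=
  (𝒜.exists_op q a).choose_spec

/-- `𝒜` is inverse-closed in `ℬ(ℓ^2)` and admits norm control there: there is a continuous
`h : [0,∞) × [0,∞) → [0,∞)` such that whenever `a ∈ 𝒜` has a bounded inverse `S` on `ℓ^2`, this
inverse is given by some `b ∈ 𝒜`, and `‖b‖_𝒜 ≤ h (‖a‖_𝒜, ‖S‖)`. -/
def AdmitsNormControl : Prop :=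
  ∃ h : ℝ × ℝ → ℝ,
    ContinuousOn h (Set.Ici 0 ×ˢ Set.Ici 0) ∧
    (∀ s t : ℝ, 0 ≤ s → 0 ≤ t → 0 ≤ h (s, t)) ∧
    ∀ (a : 𝒜.carrier) (S : Ell N 2 →L[ℝ] Ell N 2),
      (𝒜.op 2 a).comp S = ContinuousLinearMap.id ℝ _ →
      S.comp (𝒜.op 2 a) = ContinuousLinearMap.id ℝ _ →
      ∃ b : 𝒜.carrier, 𝒜.op 2 b = S ∧ 𝒜.norm b ≤ h (𝒜.norm a, ‖S‖)

end BanachMatrixAlgebra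

/-- The coordinate projection `P` on `ℓ^∞(N)` onto a set `s` of indices. -/
def coordProj {N : Type*} (s : Set N) : Ell N ∞ →L[ℝ] Ell N ∞ :=
  LinearMap.mkContinuous
    { toFun := fun x => ⟨s.indicator x, by
        refine memℓp_infty ⟨‖x‖, ?_⟩
        rintro _ ⟨i, rfl⟩
        exact (norm_indicator_le_norm_self _ _).trans
          (lp.norm_apply_le_norm ENNReal.top_ne_zero x i)⟩
      map_add' := fun x y => by
        ext i
        exact congrFun (Set.indicator_add s (x : N → ℝ) (y : N → ℝ)) i
      map_smul' := fun c x => by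
        ext i
        exact congrFun (Set.indicator_const_smul s c (x : N → ℝ)) i }
    1 (fun x => by
      rw [one_mul]
      exact lp.norm_le_of_forall_le (norm_nonneg x) fun i =>
        (norm_indicator_le_norm_self _ _).trans
          (lp.norm_apply_le_norm ENNReal.top_ne_zero x i))

/-- There are nested finite sets `N_m` exhausting `N` whose coordinate projections `P_m` satisfy
`sup_{‖A‖_𝒜 ≤ 1} ‖P_m A (I - P_{m+1})‖_{ℬ(ℓ^∞)} → 0` as `m → ∞`. -/
def BanachMatrixAlgebra.HasOffDiagonalDecay {N : Type*} (𝒜 : BanachMatrixAlgebra N) : Prop :=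
  ∃ s : ℕ → Finset N, Monotone s ∧ (∀ i, ∃ m, i ∈ s m) ∧
    Tendsto (fun m => ⨆ a : {a : 𝒜.carrier // 𝒜.norm a ≤ 1},
      ENNReal.ofReal ‖(coordProj (s m : Set N)).comp ((𝒜.op ∞ a.1).comp
        (ContinuousLinearMap.id ℝ _ - coordProj (s (m + 1) : Set N)))‖) atTop (𝓝 0)

/-- The inclusion `ℓ^p(N) ⊆ ℓ^r(N)` for `p ≤ r`. -/
def ellIncl {N : Type*} {p r : ℝ≥0∞} (h : p ≤ r) (x : Ell N p) : Ell N r :=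
  ⟨(x : N → ℝ), (lp.memℓp x).of_exponent_ge h⟩

/-- The bounded operator `T` is the gradient of `f` at `x`:
`T c = lim_{t → 0} (f (x + t c) - f x) / t` for every direction `c`. -/
def IsGradientAt {E : Type*} [NormedAddCommGroup E] [NormedSpace ℝ E]
    (f : E → E) (T : E →L[ℝ] E) (x : E) : Prop :=
  ∀ c : E, Tendsto (fun t : ℝ => t⁻¹ • (f (x + t • c) - f x)) (𝓝[≠] 0) (𝓝 (T c))

/-- The iteration `x_{n+1} = x_n - (D x_n)⁻¹ (F x_n - y)` started at `x₀`. -/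
def quasiNewton {E : Type*} [NormedAddCommGroup E] [NormedSpace ℝ E]
    (F : E → E) (D : E → E →L[ℝ] E) (y x₀ : E) : ℕ → E
  | 0 => x₀
  | n + 1 => quasiNewton F D y x₀ n -
      (D (quasiNewton F D y x₀ n)).inverse (F (quasiNewton F D y x₀ n) - y)

/-- R-quadratic convergence: the error is dominated by a sequence that converges
Q-quadratically to zero. -/
def ConvergesRQuadratically {E : Type*} [NormedAddCommGroup E] (x : ℕ → E) (l : E) : Prop :=
  ∃ ε : ℕ → ℝ, (∀ n, ‖x n - l‖ ≤ ε n) ∧ Tendsto ε atTop (𝓝 0) ∧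
    ∃ K : ℝ, ∀ n, ε (n + 1) ≤ K * ε n ^ 2

end

/-! ### Newton's method for bi-Lipschitz maps of a Banach space -/

section NewtonAbstract

variable {E : Type*} [NormedAddCommGroup E] [NormedSpace ℝ E]

/-! Average the gradient over the segment from `x'` to `x`, as an integral in `𝒜`. The resulting
matrix carries `x - x'` to `f x - f x'`, and it inherits the norm bound and the strict monotonicity
of the gradients. Lax–Milgram inverts it on `ℓ^2`. Norm control, bounded on a compact rectangle,
puts the inverse in `𝒜` with a bound uniform in `x, x'` (`exists_uniform_inverse`). Since `𝒜` acts
on every `ℓ^q`, the inverse works on `ℓ^p` too (`op_comp_op_eq_id`).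

Hence `f` restricts to a bi-Lipschitz map of `ℓ^p` whose derivative has uniformly bounded inverses
and a uniform quadratic remainder. Such a map has open and closed range, so it is onto, and Newton's
method converges quadratically near each solution (`newton_bilipschitz`). -/

theorem hasFDerivAt_of_norm_sub_le_sq {F : E → E} {T : E →L[ℝ] E} {a : E} {L : ℝ}
    (h : ∀ x, ‖F x - F a - T (x - a)‖ ≤ L * ‖x - a‖ ^ 2) : HasFDerivAt F T a := by
  refine HasFDerivAt.of_isLittleO ?_
  have h1 : (fun x => F x - F a - T (x - a)) =O[𝓝 a] fun x => ‖x - a‖ ^ 2 :=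
    Asymptotics.IsBigO.of_bound L (Eventually.of_forall fun x => by
      simpa using h x)
  refine h1.trans_isLittleO ?_
  have h2 : (fun x : E => x - a) =o[𝓝 a] fun _ => (1 : ℝ) := by
    rw [Asymptotics.isLittleO_one_iff]
    exact (continuous_id.sub continuous_const).tendsto' _ _ (by simp)
  have h3 := (Asymptotics.isBigO_refl (fun x : E => x - a) (𝓝 a)).norm_norm.mul_isLittleO h2.norm_left
  refine (h3.congr (fun x => (sq _).symm) fun x => mul_one _).trans_isBigO ?_
  exact (Asymptotics.isBigO_refl _ _).norm_left

/-- A map with Lipschitz invertible derivative that is globally bi-Lipschitz is onto. -/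
theorem surjective_of_antilipschitz_of_fderiv [CompleteSpace E] {F : E → E} {D : E → E →L[ℝ] E}
    {K L R : ℝ}
    (hquad : ∀ x a, ‖F x - F a - D a (x - a)‖ ≤ L * ‖x - a‖ ^ 2)
    (hDcont : Continuous D) (hDinv : ∀ x, (D x).IsInvertible)
    (hLip : ∀ x a, ‖F x - F a‖ ≤ R * ‖x - a‖)
    (hexp : ∀ x a, ‖x - a‖ ≤ K * ‖F x - F a‖) : Function.Surjective F := by
  choose e he using hDinv
  -- The range is open by the inverse function theorem and closed by the lower Lipschitz bound and
  -- completeness; `E` is connected.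
  have hopen : IsOpenMap F := isOpenMap_of_hasStrictFDerivAt_equiv (f' := e) fun x => by
    rw [he]
    exact hasStrictFDerivAt_of_hasFDerivAt_of_continuousAt
      (Eventually.of_forall fun a => hasFDerivAt_of_norm_sub_le_sq fun x => hquad x a)
      hDcont.continuousAt
  have hl : LipschitzWith R.toNNReal F := LipschitzWith.of_dist_le' fun x a => by
    simpa [dist_eq_norm] using hLip x a
  have ha : AntilipschitzWith K.toNNReal F := AntilipschitzWith.of_le_mul_dist fun x a => by
    rw [dist_eq_norm, dist_eq_norm]
    exact (hexp x a).trans (mul_le_mul_of_nonneg_right (Real.le_coe_toNNReal K) (norm_nonneg _))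
  rw [← Set.range_eq_univ]
  exact IsClopen.eq_univ ⟨ha.isClosed_range hl.uniformContinuous, hopen.isOpen_range⟩
    (Set.range_nonempty F)

/-- A Newton step solves the linearized equation exactly, so the new residual is just the remainder
of the linearization at the previous iterate. -/
theorem norm_quasiNewton_succ_sub_le {F : E → E} {D : E → E →L[ℝ] E} {K L : ℝ} (hK : 0 ≤ K)
    (hquad : ∀ x a, ‖F x - F a - D a (x - a)‖ ≤ L * ‖x - a‖ ^ 2)
    (hDinv : ∀ x, (D x).IsInvertible) (hDbd : ∀ x, ‖(D x).inverse‖ ≤ K) (y x₀ : E) (n : ℕ) :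
    ‖quasiNewton F D y x₀ (n + 2) - quasiNewton F D y x₀ (n + 1)‖ ≤
      K * L * ‖quasiNewton F D y x₀ (n + 1) - quasiNewton F D y x₀ n‖ ^ 2 := by
  set u := quasiNewton F D y x₀ n with hu
  set v := quasiNewton F D y x₀ (n + 1) with hv
  have h1 : quasiNewton F D y x₀ (n + 2) - v = -(D v).inverse (F v - y) := by
    change v - (D v).inverse (F v - y) - v = _
    abel
  have h2 : v - u = -(D u).inverse (F u - y) := by
    change u - (D u).inverse (F u - y) - u = _
    abel
  have h3 : D u (v - u) = -(F u - y) := by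
    rw [h2, map_neg, (hDinv u).self_apply_inverse]
  have h4 : F v - y = F v - F u - D u (v - u) := by rw [h3]; abel
  rw [h1, norm_neg, h4, mul_assoc]
  exact ((D v).inverse.le_opNorm _).trans
    (mul_le_mul (hDbd v) (hquad v u) (norm_nonneg _) hK)

/-- The new error is the inverse derivative applied to the remainder of the expansion at `u`,
evaluated at the solution `z`. -/
theorem norm_newton_step_sub_le {F : E → E} {D : E → E →L[ℝ] E} {K L : ℝ} (hK : 0 ≤ K)
    (hquad : ∀ x a, ‖F x - F a - D a (x - a)‖ ≤ L * ‖x - a‖ ^ 2)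
    (hDinv : ∀ x, (D x).IsInvertible) (hDbd : ∀ x, ‖(D x).inverse‖ ≤ K) (u z : E) :
    ‖u - (D u).inverse (F u - F z) - z‖ ≤ K * L * ‖u - z‖ ^ 2 := by
  have h : u - (D u).inverse (F u - F z) - z =
      (D u).inverse (F z - F u - D u (z - u)) := by
    rw [map_sub _ (F z - F u), (hDinv u).inverse_apply_self, ← neg_sub (F u), map_neg]
    abel
  rw [h, mul_assoc, norm_sub_rev u z]
  exact ((D u).inverse.le_opNorm _).trans
    (mul_le_mul (hDbd u) (hquad z u) (norm_nonneg _) hK)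

/-- Below the threshold, `C * ε n ≤ 1 / 2`, so each step at least halves the bound. -/
theorem tendsto_zero_of_le_mul_sq {ε : ℕ → ℝ} {C : ℝ} (hC : 0 < C) (h0 : ∀ n, 0 ≤ ε n)
    (hstart : ε 0 < 1 / (2 * C)) (h : ∀ n, ε (n + 1) ≤ C * ε n ^ 2) :
    Tendsto ε atTop (𝓝 0) := by
  have hb : ∀ n, ε n ≤ (1 / (2 * C)) * (1 / 2) ^ n := by
    have hC' : C * (1 / (2 * C)) = 1 / 2 := by field_simp
    intro n
    induction n with
    | zero => simpa using hstart.le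
    | succ n ih =>
      have hle : ε n ≤ 1 / (2 * C) := ih.trans
        (mul_le_of_le_one_right (by positivity) (pow_le_one₀ (by norm_num) (by norm_num)))
      calc ε (n + 1) ≤ C * ε n ^ 2 := h n
        _ = C * ε n * ε n := by ring
        _ ≤ C * (1 / (2 * C)) * ((1 / (2 * C)) * (1 / 2) ^ n) :=
          mul_le_mul (mul_le_mul_of_nonneg_left hle hC.le) ih (h0 n) (by positivity)
        _ = (1 / (2 * C)) * (1 / 2) ^ (n + 1) := by rw [hC']; ring
  refine squeeze_zero h0 hb ?_
  simpa using (tendsto_pow_atTop_nhds_zero_of_lt_one (r := (1 / 2 : ℝ)) (by norm_num)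
    (by norm_num)).const_mul (1 / (2 * C))

/-- Unique solvability and local quadratic convergence of Newton's method for a bi-Lipschitz map
whose derivative has uniformly bounded inverses and a uniform quadratic remainder. -/
theorem newton_bilipschitz [CompleteSpace E] {F : E → E} {D : E → E →L[ℝ] E} {K L R : ℝ}
    (hK : 0 ≤ K) (hL : 0 ≤ L)
    (hquad : ∀ x a, ‖F x - F a - D a (x - a)‖ ≤ L * ‖x - a‖ ^ 2)
    (hDcont : Continuous D) (hDinv : ∀ x, (D x).IsInvertible) (hDbd : ∀ x, ‖(D x).inverse‖ ≤ K)
    (hLip : ∀ x a, ‖F x - F a‖ ≤ R * ‖x - a‖)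
    (hexp : ∀ x a, ‖x - a‖ ≤ K * ‖F x - F a‖) :
    ∃ C : ℝ, 0 < C ∧ ∀ y : E, ∃ xs : E, (F xs = y ∧ ∀ z, F z = y → z = xs) ∧
      ∃ δ : ℝ, 0 < δ ∧ ∀ x₀ : E, ‖x₀ - xs‖ < δ →
        ∀ x : ℕ → E, x = quasiNewton F D y x₀ →
          (∀ n, 1 ≤ n → ‖x (n + 1) - x n‖ ≤ C * ‖x n - x (n - 1)‖ ^ 2) ∧
          ConvergesRQuadratically x xs ∧ Tendsto x atTop (𝓝 xs) := by
  -- The summand 1 keeps the constant positive when `K * L = 0`, so that the radius `1 / (2 * (K * L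
  -- + 1))` makes sense.
  have hC : 0 < K * L + 1 := by positivity
  refine ⟨K * L + 1, hC, fun y => ?_⟩
  obtain ⟨xs, rfl⟩ := surjective_of_antilipschitz_of_fderiv hquad hDcont hDinv hLip hexp y
  refine ⟨xs, ⟨rfl, fun z hz => ?_⟩, 1 / (2 * (K * L + 1)), by positivity, ?_⟩
  · have := hexp z xs
    rw [hz, sub_self, norm_zero, mul_zero] at this
    exact sub_eq_zero.1 (norm_le_zero_iff.1 this)
  rintro x₀ hx₀ x rfl
  have hstep : ∀ n, ‖quasiNewton F D (F xs) x₀ (n + 1) - xs‖ ≤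
      (K * L + 1) * ‖quasiNewton F D (F xs) x₀ n - xs‖ ^ 2 := fun n =>
    (norm_newton_step_sub_le hK hquad hDinv hDbd _ xs).trans
      (mul_le_mul_of_nonneg_right (by linarith) (by positivity))
  have hlim := tendsto_zero_of_le_mul_sq
    (ε := fun n => ‖quasiNewton F D (F xs) x₀ n - xs‖) hC (fun n => norm_nonneg _) hx₀ hstep
  refine ⟨fun n hn => ?_, ⟨_, fun n => le_rfl, hlim, _, hstep⟩,
    tendsto_iff_norm_sub_tendsto_zero.2 hlim⟩
  obtain ⟨n, rfl⟩ := Nat.exists_eq_add_of_le' hn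
  exact (norm_quasiNewton_succ_sub_le hK hquad hDinv hDbd _ _ n).trans
    (mul_le_mul_of_nonneg_right (by linarith) (by positivity))

end NewtonAbstract

/-! ### Inclusions between `ℓ^p` spaces and matrices acting on them -/

section EllBasics

variable {N : Type*}

theorem ellIncl_apply {p r : ℝ≥0∞} (h : p ≤ r) (x : Ell N p) (i : N) : ellIncl h x i = x i := rfl

theorem ellIncl_sub {p r : ℝ≥0∞} (h : p ≤ r) (x y : Ell N p) :
    ellIncl h (x - y) = ellIncl h x - ellIncl h y := by
  ext i
  rw [lp.coeFn_sub, Pi.sub_apply, ellIncl_apply, ellIncl_apply, ellIncl_apply, lp.coeFn_sub,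
    Pi.sub_apply]

theorem ellIncl_zero {p r : ℝ≥0∞} (h : p ≤ r) : ellIncl h (0 : Ell N p) = 0 := rfl

/-- For finite `r`, split off `|x i| ^ (r - p) ≤ ‖x‖ ^ (r - p)` from each term and sum the remaining
`p`-th powers. -/
theorem norm_ellIncl_le {p r : ℝ≥0∞} [hp1 : Fact (1 ≤ p)] (h : p ≤ r) (x : Ell N p) :
    ‖ellIncl h x‖ ≤ ‖x‖ := by
  have hp0 : p ≠ 0 := (zero_lt_one.trans_le hp1.out).ne'
  rcases eq_or_ne r ∞ with rfl | hr
  · exact lp.norm_le_of_forall_le (norm_nonneg x) fun i => lp.norm_apply_le_norm hp0 x i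
  have hp : p ≠ ∞ := ne_top_of_le_ne_top hr h
  have hpr : p.toReal ≤ r.toReal := ENNReal.toReal_mono hr h
  have hp' : 0 < p.toReal := ENNReal.toReal_pos hp0 hp
  have hr' : 0 < r.toReal := hp'.trans_le hpr
  refine lp.norm_le_of_forall_sum_le hr' (norm_nonneg x) fun s => ?_
  have hadd : r.toReal = (r.toReal - p.toReal) + p.toReal := by ring
  calc ∑ i ∈ s, ‖ellIncl h x i‖ ^ r.toReal
      ≤ ∑ i ∈ s, ‖x‖ ^ (r.toReal - p.toReal) * ‖x i‖ ^ p.toReal := by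
        refine Finset.sum_le_sum fun i _ => ?_
        rw [ellIncl_apply, hadd, Real.rpow_add_of_nonneg (norm_nonneg _) (by linarith) hp'.le]
        simp only [add_sub_cancel_right]
        gcongr
        exact lp.norm_apply_le_norm hp0 x i
    _ = ‖x‖ ^ (r.toReal - p.toReal) * ∑ i ∈ s, ‖x i‖ ^ p.toReal := by rw [Finset.mul_sum]
    _ ≤ ‖x‖ ^ (r.toReal - p.toReal) * ‖x‖ ^ p.toReal := by
        gcongr
        exact lp.sum_rpow_le_norm_rpow hp' x s
    _ = ‖x‖ ^ r.toReal := by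
        rw [← Real.rpow_add_of_nonneg (norm_nonneg _) (by linarith) hp'.le, ← hadd]

theorem continuous_ellIncl {p r : ℝ≥0∞} [Fact (1 ≤ p)] [Fact (1 ≤ r)] (h : p ≤ r) :
    Continuous (ellIncl h : Ell N p → Ell N r) := by
  refine LipschitzWith.continuous (K := 1) (LipschitzWith.of_dist_le_mul fun x y => ?_)
  rw [dist_eq_norm, dist_eq_norm, ← ellIncl_sub, NNReal.coe_one, one_mul]
  exact norm_ellIncl_le h _

/-- The rows of a matrix acting on `ℓ^∞` are absolutely summable with uniformly bounded sums. -/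
theorem Represents.summable_row {a : Matrix N N ℝ} {T : Ell N ∞ →L[ℝ] Ell N ∞}
    (h : Represents a T) (i : N) : Summable (fun j => |a i j|) ∧ ∑' j, |a i j| ≤ ‖T‖ := by
  -- Testing the operator on the signs of row `i` turns its `i`-th coordinate into the absolute row
  -- sum.
  have hm : Memℓp (fun j => (SignType.sign (a i j) : ℝ)) ∞ := by
    refine memℓp_infty ⟨1, ?_⟩
    rintro _ ⟨j, rfl⟩
    rcases lt_trichotomy (a i j) 0 with hj | hj | hj <;> simp [hj]
  let x : Ell N ∞ := ⟨_, hm⟩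
  have hx : ‖x‖ ≤ 1 := lp.norm_le_of_forall_le zero_le_one fun j => by
    change ‖(SignType.sign (a i j) : ℝ)‖ ≤ 1
    rcases lt_trichotomy (a i j) 0 with hj | hj | hj <;> simp [hj]
  have hs : HasSum (fun j => |a i j|) (T x i) := by
    convert h x i using 2 with j
    exact (self_mul_sign (a i j)).symm
  refine ⟨hs.summable, ?_⟩
  rw [hs.tsum_eq]
  calc T x i ≤ ‖T x i‖ := Real.le_norm_self _
    _ ≤ ‖T x‖ := lp.norm_apply_le_norm ENNReal.top_ne_zero _ i
    _ ≤ ‖T‖ := T.unit_le_opNorm x hx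

theorem Represents.eq {q : ℝ≥0∞} [Fact (1 ≤ q)] {a : Matrix N N ℝ} {S T : Ell N q →L[ℝ] Ell N q}
    (hS : Represents a S) (hT : Represents a T) : S = T := by
  ext x i
  exact (hS x i).unique (hT x i)

theorem Represents.apply_single {q : ℝ≥0∞} [Fact (1 ≤ q)] [DecidableEq N] {a : Matrix N N ℝ}
    {T : Ell N q →L[ℝ] Ell N q} (h : Represents a T) (i k : N) :
    T (lp.single (E := fun _ : N => ℝ) q k 1) i = a i k := by
  refine (h _ i).unique ?_
  convert hasSum_single (f := fun j => a i j * lp.single (E := fun _ : N => ℝ) q k 1 j) k ?_ using 1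
  · simp
  · intro j hj
    rw [lp.single_apply_ne (E := fun _ : N => ℝ) q k 1 hj, mul_zero]

/-- If the matrix product of `b` and `a` is the identity on unit vectors, then `b` is a left
inverse of `a` on every `ℓ^q`, provided both act on `ℓ^∞`. -/
theorem Represents.comp_eq_id {q : ℝ≥0∞} [hq : Fact (1 ≤ q)] [DecidableEq N] {a b : Matrix N N ℝ}
    {A B : Ell N ∞ →L[ℝ] Ell N ∞} (hA : Represents a A) (hB : Represents b B)
    {S T : Ell N q →L[ℝ] Ell N q} (hT : Represents a T) (hS : Represents b S)
    (hba : ∀ i k, ∑' j, b i j * a j k = if i = k then 1 else 0) :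
    S.comp T = ContinuousLinearMap.id ℝ _ := by
  have hq0 : q ≠ 0 := (zero_lt_one.trans_le hq.out).ne'
  ext x i
  change S (T x) i = x i
  rw [← (hS (T x) i).tsum_eq]
  have hrow : ∀ j, Summable fun k => ‖b i j * (a j k * x k)‖ := fun j => by
    refine Summable.of_nonneg_of_le (fun k => norm_nonneg _) (fun k => ?_)
      (((hA.summable_row j).1.mul_right ‖x‖).mul_left |b i j|)
    rw [norm_mul, norm_mul, Real.norm_eq_abs, Real.norm_eq_abs]
    gcongr
    exact lp.norm_apply_le_norm hq0 x k
  -- Absolute convergence for Fubini: entries of `x` are at most `‖x‖`, row sums of `a` at most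
  -- `‖A‖`, and row `i` of `b` is summable.
  have hsum : Summable fun jk : N × N => b i jk.1 * (a jk.1 jk.2 * x jk.2) := by
    refine Summable.of_norm ((summable_prod_of_nonneg fun _ => norm_nonneg _).2 ⟨hrow, ?_⟩)
    refine Summable.of_nonneg_of_le (fun j => tsum_nonneg fun k => norm_nonneg _) (fun j => ?_)
      ((hB.summable_row i).1.mul_right (‖A‖ * ‖x‖))
    calc ∑' k, ‖b i j * (a j k * x k)‖ ≤ ∑' k, |b i j| * (|a j k| * ‖x‖) := by
          refine (hrow j).tsum_le_tsum (fun k => ?_)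
            (((hA.summable_row j).1.mul_right ‖x‖).mul_left |b i j|)
          rw [norm_mul, norm_mul, Real.norm_eq_abs, Real.norm_eq_abs]
          gcongr
          exact lp.norm_apply_le_norm hq0 x k
      _ = |b i j| * ((∑' k, |a j k|) * ‖x‖) := by rw [tsum_mul_left, tsum_mul_right]
      _ ≤ |b i j| * (‖A‖ * ‖x‖) := by
          gcongr
          exact (hA.summable_row j).2
  calc ∑' j, b i j * T x j = ∑' j, ∑' k, b i j * (a j k * x k) := by
        refine tsum_congr fun j => ?_
        rw [tsum_mul_left, (hT x j).tsum_eq]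
    _ = ∑' k, ∑' j, b i j * (a j k * x k) :=
        (Summable.tsum_comm (f := fun j k => b i j * (a j k * x k)) hsum).symm
    _ = ∑' k, (if i = k then 1 else 0) * x k := by
        refine tsum_congr fun k => ?_
        rw [← hba i k, ← tsum_mul_right]
        exact tsum_congr fun j => (mul_assoc _ _ _).symm
    _ = x i := by
        rw [tsum_eq_single i fun k hk => by simp [hk.symm]]
        simp

end EllBasics

/-! ### Lax–Milgram inversion on a Hilbert space -/

section Coercive

variable {V : Type*} [NormedAddCommGroup V] [InnerProductSpace ℝ V] [CompleteSpace V]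

/-- A strictly monotone bounded operator on a Hilbert space has a bounded inverse. -/
theorem exists_inverse_of_strictly_monotone (T : V →L[ℝ] V) {m : ℝ} (hm : 0 < m)
    (h : ∀ c, m * inner ℝ c c ≤ inner ℝ c (T c)) :
    ∃ S : V →L[ℝ] V, T.comp S = ContinuousLinearMap.id ℝ _ ∧
      S.comp T = ContinuousLinearMap.id ℝ _ ∧ ‖S‖ ≤ 1 / m := by
  have hco : IsCoercive ((innerSL ℝ).comp T) := ⟨m, hm, fun u => by
    have := h u
    rw [real_inner_self_eq_norm_mul_norm, real_inner_comm] at this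
    simpa [mul_assoc] using this⟩
  have hT : (hco.continuousLinearEquivOfBilin : V →L[ℝ] V) = T := by
    ext v
    exact (hco.unique_continuousLinearEquivOfBilin fun w => rfl).symm
  obtain ⟨e, he⟩ : ∃ e : V ≃L[ℝ] V, (e : V →L[ℝ] V) = T := ⟨_, hT⟩
  subst he
  refine ⟨e.symm, by ext; simp, by ext; simp, ?_⟩
  refine ContinuousLinearMap.opNorm_le_bound _ (by positivity) fun v => ?_
  have h1 := (h (e.symm v)).trans (real_inner_le_norm _ _)
  simp only [ContinuousLinearEquiv.coe_coe, ContinuousLinearEquiv.apply_symm_apply,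
    real_inner_self_eq_norm_mul_norm] at h1 ⊢
  rw [one_div, ← div_eq_inv_mul, le_div_iff₀ hm]
  -- Monotonicity at `e.symm v` and Cauchy–Schwarz leave one factor `‖e.symm v‖` to cancel, so zero
  -- is treated separately.
  rcases (norm_nonneg (e.symm v)).eq_or_lt with h0 | h0
  · rw [← h0, zero_mul]
    positivity
  · refine le_of_mul_le_mul_left ?_ h0
    linarith

end Coercive

/-! ### Inversion inside the matrix algebra -/

namespace BanachMatrixAlgebra

variable {N : Type*} (𝒜 : BanachMatrixAlgebra N)

theorem norm_op_le (q : ℝ≥0∞) [Fact (1 ≤ q)] :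
    ∃ M : ℝ, 0 < M ∧ ∀ a : 𝒜.carrier, ‖𝒜.op q a‖ ≤ M * 𝒜.norm a := by
  obtain ⟨M, hM⟩ := 𝒜.embed q
  refine ⟨max M 1, by positivity, fun a => ?_⟩
  obtain ⟨T, hT, hle⟩ := hM a
  rw [(𝒜.op_represents q a).eq hT]
  exact hle.trans (mul_le_mul_of_nonneg_right (le_max_left _ _) (apply_nonneg _ _))

theorem ellIncl_op {p r : ℝ≥0∞} [Fact (1 ≤ p)] [Fact (1 ≤ r)] (h : p ≤ r) (a : 𝒜.carrier)
    (x : Ell N p) : ellIncl h (𝒜.op p a x) = 𝒜.op r a (ellIncl h x) := by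
  ext i
  exact (𝒜.op_represents p a x i).unique (𝒜.op_represents r a (ellIncl h x) i)

/-- On unit vectors the `ℓ^2` identity becomes a statement about matrix entries alone, which no
longer involves the exponent. -/
theorem op_comp_op_eq_id {a b : 𝒜.carrier}
    (h : (𝒜.op 2 b).comp (𝒜.op 2 a) = ContinuousLinearMap.id ℝ _) (q : ℝ≥0∞) [Fact (1 ≤ q)] :
    (𝒜.op q b).comp (𝒜.op q a) = ContinuousLinearMap.id ℝ _ := by
  classical
  refine (𝒜.op_represents ∞ a).comp_eq_id (𝒜.op_represents ∞ b) (𝒜.op_represents q a)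
    (𝒜.op_represents q b) fun i k => ?_
  have h1 : 𝒜.op 2 b (𝒜.op 2 a (lp.single (E := fun _ : N => ℝ) 2 k 1)) i = lp.single (E := fun _ : N => ℝ) 2 k 1 i :=
    congrArg (fun T : Ell N 2 →L[ℝ] Ell N 2 => T (lp.single (E := fun _ : N => ℝ) 2 k 1) i) h
  rw [← (𝒜.op_represents 2 b _ i).tsum_eq] at h1
  simp only [(𝒜.op_represents 2 a).apply_single] at h1
  rw [h1, lp.single_apply, Pi.single_apply]

/-- Strictly monotone matrices in `𝒜` have inverses in `𝒜`, with a uniform bound. -/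
theorem exists_uniform_inverse (hcontrol : 𝒜.AdmitsNormControl) {m M : ℝ} (hm : 0 < m) :
    ∃ B : ℝ, ∀ a : 𝒜.carrier, 𝒜.norm a ≤ M →
      (∀ c : Ell N 2, m * inner ℝ c c ≤ inner ℝ c (𝒜.op 2 a c)) →
      ∃ b : 𝒜.carrier, 𝒜.norm b ≤ B ∧ ∀ (q : ℝ≥0∞) [Fact (1 ≤ q)],
        (𝒜.op q a).comp (𝒜.op q b) = ContinuousLinearMap.id ℝ _ ∧
        (𝒜.op q b).comp (𝒜.op q a) = ContinuousLinearMap.id ℝ _ := by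
  obtain ⟨h, hcont, -, hinv⟩ := hcontrol
  -- The pairs of norms that occur stay in this rectangle, where the continuous control function is
  -- bounded; this makes the inverses uniform.
  have hcpt : IsCompact (Set.Icc (0 : ℝ) M ×ˢ Set.Icc (0 : ℝ) (1 / m)) :=
    isCompact_Icc.prod isCompact_Icc
  obtain ⟨B, hB⟩ := (hcpt.image_of_continuousOn (hcont.mono
    (Set.prod_mono Set.Icc_subset_Ici_self Set.Icc_subset_Ici_self))).bddAbove
  refine ⟨B, fun a ha hmono => ?_⟩
  obtain ⟨S, hS1, hS2, hS⟩ := exists_inverse_of_strictly_monotone (𝒜.op 2 a) hm hmono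
  obtain ⟨b, rfl, hb⟩ := hinv a S hS1 hS2
  exact ⟨b, hb.trans (hB ⟨_, ⟨⟨apply_nonneg _ _, ha⟩, norm_nonneg _, hS⟩, rfl⟩),
    fun q _ => ⟨𝒜.op_comp_op_eq_id hS1 q, 𝒜.op_comp_op_eq_id hS2 q⟩⟩

end BanachMatrixAlgebra

/-! ### `𝒜` as a Banach space, so that `𝒜`-valued integrals are available -/

namespace BanachMatrixAlgebra

variable {N : Type*} (𝒜 : BanachMatrixAlgebra N)

/-- The underlying vector space of `𝒜`, as a Banach space with the norm of `𝒜`. -/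
def Space : Type _ := 𝒜.carrier

namespace Space

instance : AddCommGroup 𝒜.Space := inferInstanceAs (AddCommGroup 𝒜.carrier)

instance : Module ℝ 𝒜.Space := inferInstanceAs (Module ℝ 𝒜.carrier)

instance : Norm 𝒜.Space := ⟨fun a => 𝒜.norm a⟩

theorem normedSpaceCore : NormedSpace.Core ℝ 𝒜.Space where
  norm_nonneg a := apply_nonneg 𝒜.norm a
  norm_smul c a := map_smul_eq_mul 𝒜.norm c a
  norm_triangle a b := map_add_le_add 𝒜.norm a b
  norm_eq_zero_iff a := ⟨𝒜.eq_zero_of_norm a, fun h => h ▸ map_zero 𝒜.norm⟩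

noncomputable instance : NormedAddCommGroup 𝒜.Space := NormedAddCommGroup.ofCore (normedSpaceCore 𝒜)

noncomputable instance : NormedSpace ℝ 𝒜.Space := NormedSpace.ofCore (normedSpaceCore 𝒜)

instance : CompleteSpace 𝒜.Space := by
  refine Metric.complete_of_cauchySeq_tendsto fun u hu => ?_
  obtain ⟨a, ha⟩ := 𝒜.complete u fun ε hε => by
    obtain ⟨n₀, h⟩ := Metric.cauchySeq_iff.1 hu ε hε
    exact ⟨n₀, fun m hm n hn => (dist_eq_norm (u m) (u n)).symm.trans_lt (h m hm n hn)⟩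
  exact ⟨a, tendsto_iff_norm_sub_tendsto_zero.2 ha⟩

end Space

/-- The embedding of `𝒜` into the bounded operators on `ℓ^q`. -/
noncomputable def opL (q : ℝ≥0∞) [Fact (1 ≤ q)] : 𝒜.Space →L[ℝ] Ell N q →L[ℝ] Ell N q :=
  LinearMap.mkContinuous
    { toFun := fun a => 𝒜.op q a
      map_add' := fun a b => by
        refine (𝒜.op_represents q (a + b : 𝒜.carrier)).eq fun x i => ?_
        have := (𝒜.op_represents q a x i).add (𝒜.op_represents q b x i)
        simp only [← add_mul] at this
        exact this
      map_smul' := fun c a => by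
        refine (𝒜.op_represents q (c • a : 𝒜.carrier)).eq fun x i => ?_
        have := (𝒜.op_represents q a x i).mul_left c
        simp only [← mul_assoc] at this
        exact this }
    (𝒜.norm_op_le q).choose fun a => (𝒜.norm_op_le q).choose_spec.2 a

theorem opL_apply (q : ℝ≥0∞) [Fact (1 ≤ q)] (a : 𝒜.Space) : 𝒜.opL q a = 𝒜.op q a := rfl

end BanachMatrixAlgebra

/-! ### Averages over segments and the mean value formula -/

section SegmentAverage

variable {E V : Type*} [NormedAddCommGroup E] [NormedSpace ℝ E]
  [NormedAddCommGroup V] [NormedSpace ℝ V]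

/-- The average of `g` over the segment from `x'` to `x`. -/
noncomputable def segmentAverage (g : E → V) (x x' : E) : V := ∫ t in (0 : ℝ)..1, g (x' + t • (x - x'))

theorem continuous_segment_comp {V : Type*} [TopologicalSpace V] {g : E → V} (hg : Continuous g) (x x' : E) :
    Continuous fun t : ℝ => g (x' + t • (x - x')) :=
  hg.comp (by fun_prop)

theorem norm_segmentAverage_le {g : E → V} {M : ℝ} (hM : ∀ x, ‖g x‖ ≤ M) (x x' : E) :
    ‖segmentAverage g x x'‖ ≤ M := by
  simpa [segmentAverage] using intervalIntegral.norm_integral_le_of_norm_le_const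
    (a := 0) (b := 1) (f := fun t : ℝ => g (x' + t • (x - x'))) fun t _ => hM _

theorem map_segmentAverage [CompleteSpace V] {W : Type*} [NormedAddCommGroup W] [NormedSpace ℝ W]
    [CompleteSpace W]
    (T : V →L[ℝ] W) {g : E → V} (hg : Continuous g) (x x' : E) :
    T (segmentAverage g x x') = segmentAverage (fun z => T (g z)) x x' :=
  (T.intervalIntegral_comp_comm
    ((continuous_segment_comp hg x x').intervalIntegrable 0 1)).symm

theorem norm_segmentAverage_sub_le [CompleteSpace V] {g : E → V} {C : ℝ} (hC : 0 ≤ C)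
    (hg : Continuous g)
    (hL : ∀ x x', ‖g x - g x'‖ ≤ C * ‖x - x'‖) (x x' : E) :
    ‖segmentAverage g x x' - g x'‖ ≤ C * ‖x - x'‖ := by
  have h : segmentAverage g x x' - g x' =
      ∫ t in (0 : ℝ)..1, (g (x' + t • (x - x')) - g x') := by
    rw [intervalIntegral.integral_sub ((continuous_segment_comp hg x x').intervalIntegrable 0 1)
      intervalIntegrable_const]
    simp [segmentAverage]
  rw [h]
  have := intervalIntegral.norm_integral_le_of_norm_le_const (a := 0) (b := 1)
    (f := fun t : ℝ => g (x' + t • (x - x')) - g x') (C := C * ‖x - x'‖) fun t ht => by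
      rw [Set.uIoc_of_le zero_le_one] at ht
      refine (hL _ _).trans (mul_le_mul_of_nonneg_left ?_ hC)
      rw [add_sub_cancel_left, norm_smul, Real.norm_of_nonneg ht.1.le]
      -- Only `t ≤ 1` is used; integrating `t` would halve the constant, which is not needed.
      exact mul_le_of_le_one_left (norm_nonneg _) ht.2
  simpa using this

/-- Along a line, directional differentiability is enough for a derivative in `t`. -/
theorem IsGradientAt.hasDerivAt_segment {f : E → E} {x x' : E} {t : ℝ} {T : E →L[ℝ] E}
    (h : IsGradientAt f T (x' + t • (x - x'))) :
    HasDerivAt (fun t : ℝ => f (x' + t • (x - x'))) (T (x - x')) t := by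
  rw [hasDerivAt_iff_tendsto_slope_zero]
  refine (h (x - x')).congr fun s => ?_
  rw [add_assoc, ← add_smul]

/-- The mean value formula for maps with continuous gradient. -/
theorem sub_eq_segmentAverage_of_isGradientAt [CompleteSpace E] {f : E → E} {D : E → E →L[ℝ] E}
    (hD : ∀ x, IsGradientAt f (D x) x) (hcont : Continuous D) (x x' : E) :
    f x - f x' = segmentAverage D x x' (x - x') := by
  have h1 := intervalIntegral.integral_eq_sub_of_hasDerivAt (a := 0) (b := 1)
    (fun t _ => (hD (x' + t • (x - x'))).hasDerivAt_segment)
    (((continuous_segment_comp hcont x x').clm_apply continuous_const).intervalIntegrable 0 1)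
  have h2 := map_segmentAverage (ContinuousLinearMap.apply ℝ E (x - x')) hcont x x'
  simp only [one_smul, zero_smul, add_zero, add_sub_cancel] at h1
  rw [← h1]
  exact h2.symm

end SegmentAverage

/-! ### Averaged gradients as matrices in `𝒜` -/

namespace BanachMatrixAlgebra

variable {N : Type*} (𝒜 : BanachMatrixAlgebra N)

theorem sub_eq_op_segmentAverage {p₀ : ℝ≥0∞} [Fact (1 ≤ p₀)] {f : Ell N p₀ → Ell N p₀}
    {Df : Ell N p₀ → 𝒜.Space} (hDf : ∀ x, IsGradientAt f (𝒜.op p₀ (Df x)) x)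
    (hcont : Continuous Df) (x x' : Ell N p₀) :
    f x - f x' = 𝒜.op p₀ (segmentAverage (V := 𝒜.Space) Df x x') (x - x') := by
  rw [sub_eq_segmentAverage_of_isGradientAt (D := fun x => 𝒜.opL p₀ (Df x)) hDf
    ((𝒜.opL p₀).continuous.comp hcont), ← map_segmentAverage (𝒜.opL p₀) hcont, opL_apply]

/-- For fixed `c` the condition bounds a continuous linear functional of the matrix from below, so
it survives averaging. -/
theorem strictly_monotone_segmentAverage {E : Type*} [NormedAddCommGroup E] [NormedSpace ℝ E]
    {Df : E → 𝒜.Space} (hcont : Continuous Df) {m : ℝ}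
    (hmono : ∀ (x : E) (c : Ell N 2), m * inner ℝ c c ≤ inner ℝ c (𝒜.op 2 (Df x) c))
    (x x' : E) (c : Ell N 2) :
    m * inner ℝ c c ≤ inner ℝ c (𝒜.op 2 (segmentAverage (V := 𝒜.Space) Df x x') c) := by
  let T : 𝒜.Space →L[ℝ] ℝ :=
    (innerSL ℝ c).comp ((ContinuousLinearMap.apply ℝ (Ell N 2) c).comp (𝒜.opL 2))
  have h := map_segmentAverage T hcont x x'
  change inner ℝ c (𝒜.op 2 (segmentAverage (V := 𝒜.Space) Df x x') c) = _ at h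
  rw [h]
  calc m * inner ℝ c c = ∫ _ in (0 : ℝ)..1, m * inner ℝ c c := by simp
    _ ≤ segmentAverage (fun z => T (Df z)) x x' :=
      intervalIntegral.integral_mono_on zero_le_one intervalIntegrable_const
        ((continuous_segment_comp (T.continuous.comp hcont) x x').intervalIntegrable 0 1)
        fun t _ => hmono _ c

end BanachMatrixAlgebra

/-! ### The main theorem -/

theorem mainTheorem11 {N : Type*} [Countable N] (𝒜 : BanachMatrixAlgebra N)
    (hcontrol : 𝒜.AdmitsNormControl) (hdecay : 𝒜.HasOffDiagonalDecay)
    (p₀ : ℝ≥0∞) [Fact (1 ≤ p₀)] (hp₀ : 2 ≤ p₀)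
    (f : Ell N p₀ → Ell N p₀) (hf : Continuous f) (hf0 : f 0 = 0)
    -- the gradient of `f`, with values in `𝒜`, bounded and continuous in `𝒜`
    (Df : Ell N p₀ → 𝒜.carrier)
    (hDf : ∀ x, IsGradientAt f (𝒜.op p₀ (Df x)) x)
    (hbdd : ∃ M : ℝ, ∀ x, 𝒜.norm (Df x) ≤ M)
    (hcont : ∀ x, Tendsto (fun x' => 𝒜.norm (Df x' - Df x)) (𝓝 x) (𝓝 0))
    -- strict monotonicity
    (m₀ : ℝ) (hm₀ : 0 < m₀)
    (hmono : ∀ (x : Ell N p₀) (c : Ell N 2),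
      m₀ * inner ℝ c c ≤ inner ℝ c (𝒜.op 2 (Df x) c))
    -- the gradient is Lipschitz into `𝒜`
    (C₁ : ℝ) (hC₁ : 0 < C₁)
    (hLip : ∀ x x', 𝒜.norm (Df x - Df x') ≤ C₁ * ‖x - x'‖)
    (p : ℝ≥0∞) [Fact (1 ≤ p)] (hp : p ≤ p₀) :
    -- every `∇f(x)` has an inverse in `𝒜`, which is its inverse on `ℓ^p`
    (∀ x : Ell N p₀, ∃ b : 𝒜.carrier,
      (𝒜.op p (Df x)).comp (𝒜.op p b) = ContinuousLinearMap.id ℝ _ ∧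
      (𝒜.op p b).comp (𝒜.op p (Df x)) = ContinuousLinearMap.id ℝ _) ∧
    -- `F` is the restriction of `f` to `ℓ^p`
    ∃ F : Ell N p → Ell N p, (∀ x, ellIncl hp (F x) = f (ellIncl hp x)) ∧
      ∃ C : ℝ, 0 < C ∧ ∀ y : Ell N p, ∃ xs : Ell N p, (F xs = y ∧ ∀ z, F z = y → z = xs) ∧
        ∃ δ : ℝ, 0 < δ ∧ ∀ x₀ : Ell N p, ‖x₀ - xs‖ < δ →
          ∀ x : ℕ → Ell N p,
            x = quasiNewton F (fun z => 𝒜.op p (Df (ellIncl hp z))) y x₀ →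
            (∀ n, 1 ≤ n → ‖x (n + 1) - x n‖ ≤ C * ‖x n - x (n - 1)‖ ^ 2) ∧
            ConvergesRQuadratically x xs ∧ Tendsto x atTop (𝓝 xs) := by
  obtain ⟨M, hM⟩ := hbdd
  obtain ⟨B, hB⟩ := 𝒜.exists_uniform_inverse hcontrol (M := M) hm₀
  have hcont' : Continuous (Y := 𝒜.Space) Df :=
    continuous_iff_continuousAt.2 fun x =>
    (tendsto_iff_norm_sub_tendsto_zero (E := 𝒜.Space)).2 (hcont x)
  refine ⟨fun x => ?_, ?_⟩
  · obtain ⟨b, -, hb⟩ := hB (Df x) (hM x) (hmono x)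
    exact ⟨b, hb p⟩
  let A : Ell N p → Ell N p → 𝒜.carrier := fun x x' =>
    segmentAverage (V := 𝒜.Space) Df (ellIncl hp x) (ellIncl hp x')
  have hA : ∀ x x', f (ellIncl hp x) - f (ellIncl hp x') =
      ellIncl hp (𝒜.op p (A x x') (x - x')) := fun x x' =>
    (𝒜.sub_eq_op_segmentAverage hDf hcont' _ _).trans
      ((𝒜.ellIncl_op hp (A x x') (x - x')).trans
        (congrArg (𝒜.op p₀ (A x x')) (ellIncl_sub hp x x'))).symm
  -- The averaged matrix on the segment from 0 to `x` also acts on `ℓ^p`; since `f 0 = 0`, this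
  -- shows that `f` preserves `ℓ^p`.
  let F : Ell N p → Ell N p := fun x => 𝒜.op p (A x 0) x
  have hF : ∀ x, ellIncl hp (F x) = f (ellIncl hp x) := fun x => by
    have := hA x 0
    rw [ellIncl_zero, hf0, sub_zero, sub_zero] at this
    exact this.symm
  have hFA : ∀ x x', F x - F x' = 𝒜.op p (A x x') (x - x') := fun x x' => by
    have h : ellIncl hp (F x - F x') = ellIncl hp (𝒜.op p (A x x') (x - x')) := by
      rw [ellIncl_sub, hF, hF, hA]
    ext i
    exact congrArg (fun z : Ell N p₀ => z i) h
  have hincl : ∀ x x' : Ell N p, ‖ellIncl hp x - ellIncl hp x'‖ ≤ ‖x - x'‖ := fun x x' => by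
    rw [← ellIncl_sub]
    exact norm_ellIncl_le hp _
  obtain ⟨Mp, hMp, hop⟩ := 𝒜.norm_op_le p
  have hinv : ∀ a : 𝒜.carrier, 𝒜.norm a ≤ M →
      (∀ c : Ell N 2, m₀ * inner ℝ c c ≤ inner ℝ c (𝒜.op 2 a c)) →
      -- `|B|` makes the bound nonnegative without a sign argument for `B`.
      (𝒜.op p a).IsInvertible ∧ ‖(𝒜.op p a).inverse‖ ≤ Mp * |B| := fun a ha hma => by
    obtain ⟨b, hb, hab⟩ := hB a ha hma
    refine ⟨.of_inverse (hab p).1 (hab p).2, ?_⟩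
    rw [ContinuousLinearMap.inverse_eq (hab p).1 (hab p).2]
    exact (hop b).trans (mul_le_mul_of_nonneg_left (hb.trans (le_abs_self B)) hMp.le)
  have hAM : ∀ x x', 𝒜.norm (A x x') ≤ M := fun x x' =>
    norm_segmentAverage_le (V := 𝒜.Space) hM _ _
  have hAmono : ∀ x x' (c : Ell N 2), m₀ * inner ℝ c c ≤ inner ℝ c (𝒜.op 2 (A x x') c) :=
    fun x x' => 𝒜.strictly_monotone_segmentAverage hcont' hmono _ _
  -- The same `K` bounds the inverses of the gradients and of the averaged matrices, so it serves
  -- both Newton's method and the lower Lipschitz bound. `L` and `R` are the Lipschitz constant and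
  -- the bound of the gradient, carried to `ℓ^p` by the embedding constant `Mp`.
  refine ⟨F, hF, newton_bilipschitz (K := Mp * |B|) (L := Mp * C₁) (R := Mp * M) (by positivity)
    (by positivity) (fun x a => ?_) ?_ (fun x => (hinv _ (hM _) (hmono _)).1)
    (fun x => (hinv _ (hM _) (hmono _)).2) (fun x a => ?_) fun x a => ?_⟩
  · have h1 : 𝒜.norm (A x a - Df (ellIncl hp a)) ≤ C₁ * ‖x - a‖ :=
      (norm_segmentAverage_sub_le (V := 𝒜.Space) hC₁.le hcont' hLip _ _).trans
        (mul_le_mul_of_nonneg_left (hincl x a) hC₁.le)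
    have h2 : 𝒜.op p (A x a - Df (ellIncl hp a)) =
        𝒜.op p (A x a) - 𝒜.op p (Df (ellIncl hp a)) :=
      map_sub (𝒜.opL p) (A x a) (Df (ellIncl hp a))
    rw [hFA, ← sub_apply, ← h2]
    calc _ ≤ ‖𝒜.op p (A x a - Df (ellIncl hp a))‖ * ‖x - a‖ :=
          ContinuousLinearMap.le_opNorm _ _
      _ ≤ Mp * (C₁ * ‖x - a‖) * ‖x - a‖ := by
          gcongr
          exact (hop _).trans (mul_le_mul_of_nonneg_left h1 hMp.le)
      _ = Mp * C₁ * ‖x - a‖ ^ 2 := by ring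
  · exact (𝒜.opL p).continuous.comp (hcont'.comp (continuous_ellIncl hp))
  · rw [hFA]
    exact (ContinuousLinearMap.le_opNorm _ _).trans (mul_le_mul_of_nonneg_right
      ((hop _).trans (mul_le_mul_of_nonneg_left (hAM x a) hMp.le)) (norm_nonneg _))
  · obtain ⟨h1, h2⟩ := hinv _ (hAM x a) (hAmono x a)
    rw [← h1.inverse_apply_self (x - a), ← hFA]
    exact (ContinuousLinearMap.le_opNorm _ _).trans
      (mul_le_mul_of_nonneg_right h2 (norm_nonneg _))
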